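/- **Setting.** Let $y = X\beta^* + \varepsilon$, where $X\in\mathbb R^{n\times p}$ ($p\ge 1$) satisfies $\|X\|_2\le 1$, $\beta^*\in\mathbb R^p$, and $\varepsilon$ is a mean-zero sub-Gaussian random vector in $\mathbb R^n$ with scale bounded by $\sigma\ge 0$: every $\langle\varepsilon,a\rangle$ is sub-Gaussian with $\|\langle\varepsilon,a\rangle\|_{\psi_2}\le\sigma\|a\|_2$, where $\|\xi\|_{\psi_2}=\inf\{s>0: E\exp(\xi^2/s^2)\le 2\}$. Let $\Theta(t;\lambda)$ ($t\in\mathbb R$, $\lambda\ge 0$) be a thresholding function, i.e. for each $\lambda$ it is odd and non-decreasing in $t$, tends to $\infty$ as $t\to\infty$, and satisfies $0\le\Theta(t;\lambda)\le t$ for $t\ge 0$. Applied to a vector, $\Theta$ acts componentwise. Put $$\Theta^{-1}(u;\lambda)=\sup\{t:\Theta(t;\lambda)\le u\},\qquad \mathcal L_\Theta = 1-\operatorname{ess\,inf}\Big\{\tfrac{d}{du}\Theta^{-1}(u;\lambda): u\ge 0\Big\},$$ $$P_\Theta(t;\lambda)=\int_0^{|t|}(\Theta^{-1}(u;\lambda)-u)\,du,\qquad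 P_H(t;\lambda)=\Big(-\tfrac{t^2}{2}+\lambda|t|\Big)1_{|t|<\lambda}+\tfrac{\lambda^2}{2}1_{|t|\ge\lambda},$$ with $P_\Theta(\beta;\lambda)=\sum_j P_\Theta(\beta_j;\lambda)$ and $P_H(\beta;\lambda)=\sum_j P_H(\beta_j;\lambda)$. Let $J(\beta)=\#\{j:\beta_j\ne 0\}$, $J^*=J(\beta^*)$ and $\|v\|_M=(v^TMv)^{1/2}$. Given any, possibly random, starting point $\beta^{(0)}$, let $$\beta^{(t+1)}=\Theta\big(\beta^{(t)}+X^Ty-X^TX\beta^{(t)};\lambda\big),\qquad t\ge 0.$$ For $\delta>0$, $\vartheta>0$, $K\ge 0$ consider the conditions $$\mathcal S_0(\delta,\vartheta,K,\beta,\beta',\lambda):\quad \vartheta P_H(\beta'-\beta;\lambda)+\tfrac{\mathcal L_\Theta+\delta}{2}\|\beta'-\beta\|_2^2\le\|X(\beta'-\beta)\|_2^2+P_\Theta(\beta';\lambda)+KP_\Theta(\beta;\lambda),$$ $$\mathcal S_1(\delta,\vartheta,K,\beta,\beta',\lambda):\quad \vartheta P_H(\beta'-\beta;\lambda)+\tfrac{\mathcal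 L_\Theta+\delta}{2}\|\beta'-\beta\|_2^2+P_\Theta(\beta;\lambda)\le\|X(\beta'-\beta)\|_2^2+P_\Theta(\beta';\lambda)+(K+1)\lambda^2J(\beta).$$ **Theorem.** There are universal constants $A_0, C, c>0$ such that the following holds in this setting for all $\delta>0$, $\vartheta>0$, $K\ge 0$, $A\ge A_0$ and $t\ge 0$, with $\lambda = A\sigma\sqrt{\log(ep)}/\sqrt{(\delta\wedge\vartheta)\vartheta}$. (i) With probability at least $1-Cp^{-cA^2}$, the following implication is true: if $\mathcal S_0(\delta,\vartheta,K,\beta^*,\beta^{(t+1)},\lambda)$ is satisfied, then $$\frac{1+\delta}{2}\|\beta^{(t+1)}-\beta^*\|_{I-X^TX}^2\le\frac12\|\beta^{(t)}-\beta^*\|_{I-X^TX}^2+(K+1)P_\Theta(\beta^*;\lambda).$$ (ii) With probability at least $1-Cp^{-cA^2}$, the following implication is true: if $\mathcal S_1(\delta,\vartheta,K,\beta^*,\beta^{(t+1)},\lambda)$ is satisfied, then $$\frac{1+\delta}{2}\|\beta^{(t+1)}-\beta^*\|_{I-X^TX}^2\le\frac12\|\beta^{(t)}-\beta^*\|_{I-X^TX}^2+(K+1)\lambda^2J^*.$$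 In particular, if the condition in (i) (respectively (ii)) is satisfied almost surely, then the corresponding bound holds with probability at least $1-Cp^{-cA^2}$. -/

import Mathlib

open MeasureTheory Filter
open scoped ENNReal

noncomputable section

namespace ThetaEst

/-- Thresholding functions `Θ(t; lam)`, `t ∈ ℝ`, `lam ≥ 0`, written `Θ t lam`. -/
structure IsThresholding (Θ : ℝ → ℝ → ℝ) : Prop where
  odd : ∀ lam, 0 ≤ lam → ∀ t, Θ (-t) lam = -Θ t lam
  mono : ∀ lam, 0 ≤ lam → ∀ t t', t ≤ t' → Θ t lam ≤ Θ t' lam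
  tendsto : ∀ lam, 0 ≤ lam → Tendsto (fun t => Θ t lam) atTop atTop
  nonneg : ∀ lam, 0 ≤ lam → ∀ t, 0 ≤ t → 0 ≤ Θ t lam
  le_self : ∀ lam, 0 ≤ lam → ∀ t, 0 ≤ t → Θ t lam ≤ t

/-- `Θ⁻¹(u; lam) = sup {t : Θ(t; lam) ≤ u}`. For a thresholding function and `u ≥ 0` the set is
nonempty and bounded above. -/
def thetaInv (Θ : ℝ → ℝ → ℝ) (lam u : ℝ) : ℝ := sSup {t : ℝ | Θ t lam ≤ u}

/-- The critical number `L_Θ = 1 - essinf {dΘ⁻¹(u; lam)/du : u ≥ 0}`, with respect to Lebesgue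
measure. The monotone function `Θ⁻¹(·; lam)` is differentiable almost everywhere. -/
def critNumber (Θ : ℝ → ℝ → ℝ) (lam : ℝ) : ℝ :=
  1 - essInf (fun u => deriv (thetaInv Θ lam) u) (volume.restrict (Set.Ioi (0 : ℝ)))

/-- The scalar penalty `P_Θ(t; lam) = ∫_0^{|t|} (Θ⁻¹(u; lam) - u) du`. -/
def penTheta (Θ : ℝ → ℝ → ℝ) (lam t : ℝ) : ℝ :=
  ∫ u in (0 : ℝ)..|t|, (thetaInv Θ lam u - u)

open Classical in
/-- The scalar hard-thresholding penalty `P_H(t; lam)`. -/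
def penH (lam t : ℝ) : ℝ :=
  if |t| < lam then -t ^ 2 / 2 + lam * |t| else lam ^ 2 / 2

/-- `P_Θ(β; lam) = ∑ⱼ P_Θ(βⱼ; lam)`. -/
def penThetaVec {p : ℕ} (Θ : ℝ → ℝ → ℝ) (lam : ℝ) (β : EuclideanSpace ℝ (Fin p)) : ℝ :=
  ∑ j, penTheta Θ lam (β j)

/-- `P_H(β; lam) = ∑ⱼ P_H(βⱼ; lam)`. -/
def penHVec {p : ℕ} (lam : ℝ) (β : EuclideanSpace ℝ (Fin p)) : ℝ :=
  ∑ j, penH lam (β j)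

/-- `J(β) = #{j : βⱼ ≠ 0}`. -/
def numNonzero {p : ℕ} (β : EuclideanSpace ℝ (Fin p)) : ℕ := {j | β j ≠ 0}.ncard

/-- The matrix `X` as a continuous linear map between Euclidean spaces; its operator norm is the
spectral norm `‖X‖₂`. -/
def euclMap {n p : ℕ} (X : Matrix (Fin n) (Fin p) ℝ) :
    EuclideanSpace ℝ (Fin p) →L[ℝ] EuclideanSpace ℝ (Fin n) :=
  LinearMap.toContinuousLinearMap (Matrix.toEuclideanLin X)

/-- `‖v‖_M = (vᵀ M v)^{1/2}`, for a positive semidefinite matrix `M`. -/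
def weightedNorm {p : ℕ} (M : Matrix (Fin p) (Fin p) ℝ) (v : EuclideanSpace ℝ (Fin p)) : ℝ :=
  Real.sqrt (inner ℝ v (euclMap M v))

/-- The componentwise version of `Θ(·; lam)`. -/
def thetaVec {p : ℕ} (Θ : ℝ → ℝ → ℝ) (lam : ℝ) (v : EuclideanSpace ℝ (Fin p)) :
    EuclideanSpace ℝ (Fin p) :=
  WithLp.toLp 2 (fun j => Θ (v j) lam)

/-- The iterates `β^{(t+1)} = Θ(β^{(t)} + Xᵀ y - Xᵀ X β^{(t)}; lam)` started at `β₀`. -/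
def tisp {n p : ℕ} (Θ : ℝ → ℝ → ℝ) (lam : ℝ) (X : Matrix (Fin n) (Fin p) ℝ)
    (y : EuclideanSpace ℝ (Fin n)) (β₀ : EuclideanSpace ℝ (Fin p)) :
    ℕ → EuclideanSpace ℝ (Fin p)
  | 0 => β₀
  | t + 1 => thetaVec Θ lam
      (tisp Θ lam X y β₀ t + euclMap X.transpose y
        - euclMap (X.transpose * X) (tisp Θ lam X y β₀ t))

/-- The inequality of condition `S₀(δ, ϑ, K, β, β', lam)`. -/
def CondS0 {n p : ℕ} (X : Matrix (Fin n) (Fin p) ℝ) (Θ : ℝ → ℝ → ℝ) (δ ϑ K : ℝ)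
    (β β' : EuclideanSpace ℝ (Fin p)) (lam : ℝ) : Prop :=
  ϑ * penHVec lam (β' - β) + (critNumber Θ lam + δ) / 2 * ‖β' - β‖ ^ 2
    ≤ ‖euclMap X (β' - β)‖ ^ 2 + penThetaVec Θ lam β' + K * penThetaVec Θ lam β

/-- The inequality of condition `S₁(δ, ϑ, K, β, β', lam)`. -/
def CondS1 {n p : ℕ} (X : Matrix (Fin n) (Fin p) ℝ) (Θ : ℝ → ℝ → ℝ) (δ ϑ K : ℝ)
    (β β' : EuclideanSpace ℝ (Fin p)) (lam : ℝ) : Prop :=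
  ϑ * penHVec lam (β' - β) + (critNumber Θ lam + δ) / 2 * ‖β' - β‖ ^ 2
      + penThetaVec Θ lam β
    ≤ ‖euclMap X (β' - β)‖ ^ 2 + penThetaVec Θ lam β' + (K + 1) * lam ^ 2 * numNonzero β

section Noise

variable {Ω : Type*} [MeasurableSpace Ω]

/-- Sub-Gaussian random variable, through its tails. -/
def IsSubGaussianVar (ξ : Ω → ℝ) (μ : Measure Ω) : Prop :=
  ∃ C c : ℝ, 0 < C ∧ 0 < c ∧
    ∀ t : ℝ, 0 < t → μ {ω | t ≤ |ξ ω|} ≤ ENNReal.ofReal (C * Real.exp (-c * t ^ 2))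

/-- The `ψ₂`-norm `inf {s > 0 : E exp(ξ² / s²) ≤ 2}`, equal to `∞` if there is no such `s`. -/
def psi2Norm (ξ : Ω → ℝ) (μ : Measure Ω) : ℝ≥0∞ :=
  ⨅ (s : ℝ) (_ : 0 < s ∧ ∫⁻ ω, ENNReal.ofReal (Real.exp (ξ ω ^ 2 / s ^ 2)) ∂μ ≤ 2),
    ENNReal.ofReal s

/-- A sub-Gaussian random vector with mean zero and scale bounded by `σ`. -/
structure IsSubGaussianVec {n : ℕ} (ε : Ω → EuclideanSpace ℝ (Fin n)) (μ : Measure Ω)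
    (σ : ℝ) : Prop where
  aemeasurable : AEMeasurable ε μ
  mean_zero : ∫ ω, ε ω ∂μ = 0
  marginal : ∀ a : EuclideanSpace ℝ (Fin n), IsSubGaussianVar (fun ω => inner ℝ (ε ω) a) μ
  scale : ∀ a : EuclideanSpace ℝ (Fin n),
    psi2Norm (fun ω => inner ℝ (ε ω) a) μ ≤ ENNReal.ofReal (σ * ‖a‖)

end Noise

end ThetaEst

end

/-!
Put `d = β^{(t)} - β*`, `d' = β^{(t+1)} - β*`.

The proof separates a deterministic inequality for one step of the iteration from a single
probabilistic event that does not depend on the iterates.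

*Deterministic part.* Since `Θ(z; lam)` minimizes `b ↦ ‖b - z‖² / 2 + P_Θ(b; lam)`, and `Θ⁻¹` has slope
at least `1 - L_Θ`, this objective grows quadratically, with rate `1 - L_Θ`, away from its minimum
(`IsThresholding.quadratic_growth`). The slope bound comes from the inequality
`∫ f' ≤ f(v) - f(u)` for monotone `f`. At `b = β*`, after splitting the cross term
`⟨d', (I - XᵀX) d⟩` by Cauchy–Schwarz, this is `IsThresholding.basic_inequality`. Adding the
comparison condition yields the claim (in fact with `δ ‖X d'‖² / 2 + ϑ P_H(d')` to spare), up to the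
stochastic term `⟨ε, X d'⟩`.

*Stochastic part.* It remains to dominate `⟨ε, X d⟩` by `δ ‖X d‖² / 2 + ϑ P_H(d; lam)` for all `d` at
once, so that no assumption on how the iterates depend on `ε` is needed
(`IsSubGaussianVec.exists_event_inner_le`). By a concavity argument in each coordinate
(`inner_le_penHVec`) only vectors whose nonzero entries are at least `lam` in size matter, and for
these `P_H` is `lam² J(d) / 2`. By Cauchy–Schwarz, it then suffices that for every nonempty set `S`
of coordinates the projection of `ε` on the span of the columns in `S` has squared norm at most
`A² σ² |S| log(ep)`. The tail of that norm is controlled by an exponential moment, computed with an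
auxiliary Gaussian integral over the subspace
(`IsSubGaussianVec.lintegral_exp_sq_norm_starProjection_le`), and a union bound over `S` concludes.
-/

namespace ThetaEst

/-! ### Thresholding as penalized least squares -/

section Threshold

variable {Θ : ℝ → ℝ → ℝ} {lam : ℝ}

theorem IsThresholding.bddAbove_setOf_le (hΘ : IsThresholding Θ) (hlam : 0 ≤ lam) (u : ℝ) :
    BddAbove {t : ℝ | Θ t lam ≤ u} := by
  obtain ⟨T, hT⟩ := ((hΘ.tendsto lam hlam).eventually_gt_atTop u).exists
  refine ⟨T, fun t ht => ?_⟩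
  by_contra! h
  exact absurd (hT.trans_le (hΘ.mono lam hlam T t h.le)) (not_lt.mpr ht)

theorem IsThresholding.nonempty_setOf_le (hΘ : IsThresholding Θ) (hlam : 0 ≤ lam) (u : ℝ) :
    {t : ℝ | Θ t lam ≤ u}.Nonempty := by
  obtain ⟨T, hT⟩ := ((hΘ.tendsto lam hlam).eventually_ge_atTop (-u)).exists
  refine ⟨-T, ?_⟩
  rw [Set.mem_ofPred_eq, hΘ.odd lam hlam]
  linarith

theorem IsThresholding.monotone_thetaInv (hΘ : IsThresholding Θ) (hlam : 0 ≤ lam) :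
    Monotone (thetaInv Θ lam) := fun u v huv =>
  csSup_le_csSup (hΘ.bddAbove_setOf_le hlam v) (hΘ.nonempty_setOf_le hlam u)
    fun _ ht => le_trans ht huv

theorem IsThresholding.le_thetaInv (hΘ : IsThresholding Θ) (hlam : 0 ≤ lam) {t u : ℝ}
    (h : Θ t lam ≤ u) : t ≤ thetaInv Θ lam u :=
  le_csSup (hΘ.bddAbove_setOf_le hlam u) h

theorem IsThresholding.thetaInv_le (hΘ : IsThresholding Θ) (hlam : 0 ≤ lam) {t u : ℝ}
    (h : u < Θ t lam) : thetaInv Θ lam u ≤ t := by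
  refine csSup_le (hΘ.nonempty_setOf_le hlam u) fun s hs => ?_
  by_contra! hts
  exact absurd (h.trans_le (hΘ.mono lam hlam t s hts.le)) (not_lt.mpr hs)

/-- The essential infimum in `L_Θ` is taken in `ℝ`, so that the derivative has to be bounded below for
this to hold: it is nonnegative, as `Θ⁻¹(·; lam)` is monotone. -/
theorem IsThresholding.ae_le_deriv_thetaInv (hΘ : IsThresholding Θ) (hlam : 0 ≤ lam) :
    ∀ᵐ u ∂(volume.restrict (Set.Ioi (0 : ℝ))),
      1 - critNumber Θ lam ≤ deriv (thetaInv Θ lam) u := by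
  have h := ae_essInf_le (μ := volume.restrict (Set.Ioi (0 : ℝ)))
    (f := fun u => deriv (thetaInv Θ lam) u)
    ⟨0, by
      simp only [ge_iff_le, eventually_map]
      exact Eventually.of_forall fun u => (hΘ.monotone_thetaInv hlam).deriv_nonneg⟩
  filter_upwards [h] with u hu
  simpa [critNumber] using hu

/-- `Θ⁻¹(·; lam)` grows at least linearly, with slope `1 - L_Θ`; jumps and a singular part of the
monotone function `Θ⁻¹` only help. -/
theorem IsThresholding.mul_sub_le_thetaInv_sub (hΘ : IsThresholding Θ) (hlam : 0 ≤ lam) {u v : ℝ}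
    (hu : 0 ≤ u) (huv : u ≤ v) :
    (1 - critNumber Θ lam) * (v - u) ≤ thetaInv Θ lam v - thetaInv Θ lam u := by
  have hm := hΘ.monotone_thetaInv hlam
  have hmem := (hm.monotoneOn (Set.uIcc u v)).intervalIntegral_deriv_mem_uIcc
  rw [Set.uIcc_of_le (sub_nonneg.mpr (hm huv))] at hmem
  refine le_trans ?_ hmem.2
  have hint := (hm.monotoneOn (Set.uIcc u v)).intervalIntegrable_deriv
  have hc : ∫ _ in u..v, (1 - critNumber Θ lam) = (1 - critNumber Θ lam) * (v - u) := by
    rw [intervalIntegral.integral_const, smul_eq_mul, mul_comm]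
  rw [← hc]
  refine intervalIntegral.integral_mono_ae_restrict huv (by simp) hint ?_
  refine ae_restrict_of_ae_restrict_of_subset (s := Set.Icc u v) (t := Set.Ici 0)
    (fun x hx => hu.trans hx.1) ?_
  rw [← restrict_Ioi_eq_restrict_Ici]
  exact hΘ.ae_le_deriv_thetaInv hlam

/-- For `u ≥ Θ(z; lam)`, the slope bound starts from `Θ⁻¹(Θ(z; lam); lam) ≥ z`. -/
theorem IsThresholding.add_le_thetaInv (hΘ : IsThresholding Θ) (hlam : 0 ≤ lam) {z u : ℝ}
    (hz : 0 ≤ z) (hu : Θ z lam ≤ u) :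
    z + (1 - critNumber Θ lam) * (u - Θ z lam) ≤ thetaInv Θ lam u := by
  have h1 := hΘ.mul_sub_le_thetaInv_sub hlam (hΘ.nonneg lam hlam z hz) hu
  have h2 := hΘ.le_thetaInv hlam (le_refl (Θ z lam))
  linarith

/-- For `u < Θ(z; lam)`, the slope bound ends at the left limit of `Θ⁻¹(·; lam)` at `Θ(z; lam)`, which
is at most `z`; the value there may be larger. -/
theorem IsThresholding.thetaInv_le_add (hΘ : IsThresholding Θ) (hlam : 0 ≤ lam) {z u : ℝ}
    (hu0 : 0 ≤ u) (hu : u < Θ z lam) :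
    thetaInv Θ lam u ≤ z + (1 - critNumber Θ lam) * (u - Θ z lam) := by
  -- let `v` increase to `Θ z lam` in the bound for the slope between `u` and `v`
  have hlim : Tendsto (fun v => z + (1 - critNumber Θ lam) * (u - v))
      (nhdsWithin (Θ z lam) (Set.Iio (Θ z lam)))
      (nhds (z + (1 - critNumber Θ lam) * (u - Θ z lam))) := by
    refine Tendsto.mono_left (Continuous.tendsto (by fun_prop) _) nhdsWithin_le_nhds
  refine ge_of_tendsto hlim ?_
  filter_upwards [Ioo_mem_nhdsLT hu] with v hv
  have h1 := hΘ.mul_sub_le_thetaInv_sub hlam hu0 hv.1.le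
  have h2 := hΘ.thetaInv_le hlam hv.2
  linarith

theorem penTheta_neg (t : ℝ) : penTheta Θ lam (-t) = penTheta Θ lam t := by simp [penTheta]

theorem IsThresholding.intervalIntegrable_thetaInv (hΘ : IsThresholding Θ) (hlam : 0 ≤ lam)
    (a b : ℝ) : IntervalIntegrable (thetaInv Θ lam) volume a b :=
  (hΘ.monotone_thetaInv hlam).intervalIntegrable

theorem IsThresholding.penTheta_sub (hΘ : IsThresholding Θ) (hlam : 0 ≤ lam) {b b' : ℝ}
    (hb : 0 ≤ b) (hb' : 0 ≤ b') :
    penTheta Θ lam b - penTheta Θ lam b' = ∫ u in b'..b, (thetaInv Θ lam u - u) := by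
  rw [penTheta, penTheta, abs_of_nonneg hb, abs_of_nonneg hb']
  exact intervalIntegral.integral_interval_sub_left
    ((hΘ.intervalIntegrable_thetaInv hlam _ _).sub (by simp))
    ((hΘ.intervalIntegrable_thetaInv hlam _ _).sub (by simp))

theorem integral_linear (z k c a b : ℝ) :
    ∫ u in a..b, (z + k * (u - c) - u)
      = z * (b - a) + k * ((b - c) ^ 2 - (a - c) ^ 2) / 2 - (b ^ 2 - a ^ 2) / 2 := by
  rw [intervalIntegral.integral_eq_sub_of_hasDerivAt
    (f := fun u => z * u + k * (u - c) ^ 2 / 2 - u ^ 2 / 2)]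
  · ring
  · intro x _
    have h1 := ((hasDerivAt_id x).const_mul z)
    have h2 := ((((hasDerivAt_id x).sub_const c).pow 2).const_mul k).div_const 2
    have h3 := ((hasDerivAt_id x).pow 2).div_const 2
    convert! (h1.add h2).sub h3 using 1
    simp; ring
  · exact (Continuous.intervalIntegrable (by fun_prop) _ _)

/-- `Θ(z; lam)` minimizes `b ↦ (b - z)² / 2 + P_Θ(b; lam)`, with quadratic growth of rate
`1 - L_Θ` away from the minimum: the case of points of the same sign. -/
theorem IsThresholding.quadratic_growth_of_nonneg (hΘ : IsThresholding Θ) (hlam : 0 ≤ lam)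
    {b z : ℝ} (hb : 0 ≤ b) (hz : 0 ≤ z) :
    (Θ z lam - z) ^ 2 / 2 + penTheta Θ lam (Θ z lam)
        + (1 - critNumber Θ lam) / 2 * (b - Θ z lam) ^ 2
      ≤ (b - z) ^ 2 / 2 + penTheta Θ lam b := by
  set w := Θ z lam with hw
  have hw0 : 0 ≤ w := hΘ.nonneg lam hlam z hz
  have hint : ∀ a b, IntervalIntegrable (fun u => thetaInv Θ lam u - u) volume a b :=
    fun a b => (hΘ.intervalIntegrable_thetaInv hlam a b).sub (by simp)
  have hlin : ∀ a b, IntervalIntegrable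
      (fun u => z + (1 - critNumber Θ lam) * (u - w) - u) volume a b :=
    fun a b => Continuous.intervalIntegrable (by fun_prop) _ _
  have hkey : ∫ u in w..b, (z + (1 - critNumber Θ lam) * (u - w) - u)
      ≤ ∫ u in w..b, (thetaInv Θ lam u - u) := by
    rcases le_total w b with hwb | hbw
    · refine intervalIntegral.integral_mono_on hwb (hlin _ _) (hint _ _) fun u hu => ?_
      have := hΘ.add_le_thetaInv hlam hz (u := u) hu.1
      linarith
    · rw [intervalIntegral.integral_symm b w, intervalIntegral.integral_symm b w, neg_le_neg_iff]
      refine intervalIntegral.integral_mono_on_of_le_Ioo hbw (hint _ _) (hlin _ _) fun u hu => ?_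
      have := hΘ.thetaInv_le_add hlam (hb.trans hu.1.le) hu.2
      linarith
  rw [← hΘ.penTheta_sub hlam hb hw0, integral_linear] at hkey
  nlinarith

/-- `Θ(z; lam)` minimizes `b ↦ (b - z)² / 2 + P_Θ(b; lam)`, with quadratic growth of rate
`1 - L_Θ` away from the minimum. -/
theorem IsThresholding.quadratic_growth (hΘ : IsThresholding Θ) (hlam : 0 ≤ lam) (b z : ℝ) :
    (Θ z lam - z) ^ 2 / 2 + penTheta Θ lam (Θ z lam)
        + (1 - critNumber Θ lam) / 2 * (b - Θ z lam) ^ 2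
      ≤ (b - z) ^ 2 / 2 + penTheta Θ lam b := by
  wlog hz : 0 ≤ z generalizing b z
  · have h := this (-b) (-z) (by linarith)
    rw [hΘ.odd lam hlam, penTheta_neg, penTheta_neg] at h
    linarith [h, sq_abs (b - z)]
  rcases le_total 0 b with hb | hb
  · exact hΘ.quadratic_growth_of_nonneg hlam hb hz
  · have h := hΘ.quadratic_growth_of_nonneg hlam (b := -b) (by linarith) hz
    rw [penTheta_neg] at h
    -- reflecting `b` costs `4 |b| Θ z` in the growth term, and gains `2 |b| z` in the halved square
    have hk : (1 - critNumber Θ lam) * Θ z lam ≤ z := by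
      rcases (hΘ.nonneg lam hlam z hz).eq_or_lt with h0 | h0
      · simpa [← h0] using hz
      · have h1 := hΘ.thetaInv_le_add hlam le_rfl h0
        have h2 := hΘ.le_thetaInv hlam (t := 0) (u := 0) (hΘ.le_self lam hlam 0 le_rfl)
        linarith
    nlinarith [mul_le_mul_of_nonneg_left hk (neg_nonneg.mpr hb)]

/-- Summing the scalar growth bounds over the coordinates. -/
theorem IsThresholding.quadratic_growth_vec (hΘ : IsThresholding Θ) (hlam : 0 ≤ lam) {p : ℕ}
    (b z : EuclideanSpace ℝ (Fin p)) :
    ‖thetaVec Θ lam z - z‖ ^ 2 / 2 + penThetaVec Θ lam (thetaVec Θ lam z)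
        + (1 - critNumber Θ lam) / 2 * ‖b - thetaVec Θ lam z‖ ^ 2
      ≤ ‖b - z‖ ^ 2 / 2 + penThetaVec Θ lam b := by
  simp only [EuclideanSpace.real_norm_sq_eq, penThetaVec, Finset.sum_div, Finset.mul_sum,
    ← Finset.sum_add_distrib]
  exact Finset.sum_le_sum fun j _ => hΘ.quadratic_growth hlam (b j) (z j)

end Threshold

/-! ### One step of the iteration -/

section Iteration

variable {n p : ℕ} (X : Matrix (Fin n) (Fin p) ℝ)

theorem inner_euclMap_transpose (v : EuclideanSpace ℝ (Fin p)) (w : EuclideanSpace ℝ (Fin n)) :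
    inner ℝ v (euclMap X.transpose w) = inner ℝ (euclMap X v) w := by
  have h := Matrix.toEuclideanLin_conjTranspose_eq_adjoint X
  rw [Matrix.conjTranspose_eq_transpose_of_trivial] at h
  simp only [euclMap, LinearMap.coe_toContinuousLinearMap', h]
  exact LinearMap.adjoint_inner_right _ _ _

theorem euclMap_mul_transpose (v : EuclideanSpace ℝ (Fin p)) :
    euclMap (X.transpose * X) v = euclMap X.transpose (euclMap X v) := by
  ext j
  simp [euclMap, Matrix.toLpLin_apply]

theorem euclMap_one_sub (v : EuclideanSpace ℝ (Fin p)) :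
    euclMap (1 - X.transpose * X) v = v - euclMap X.transpose (euclMap X v) := by
  rw [← euclMap_mul_transpose]
  ext j
  simp [euclMap, Matrix.toLpLin_apply]

theorem norm_euclMap_le (hX : ‖euclMap X‖ ≤ 1) (v : EuclideanSpace ℝ (Fin p)) :
    ‖euclMap X v‖ ≤ ‖v‖ := by
  simpa using (euclMap X).le_of_opNorm_le hX v

theorem weightedNorm_sq (hX : ‖euclMap X‖ ≤ 1) (v : EuclideanSpace ℝ (Fin p)) :
    weightedNorm (1 - X.transpose * X) v ^ 2 = ‖v‖ ^ 2 - ‖euclMap X v‖ ^ 2 := by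
  have h : inner ℝ v (euclMap (1 - X.transpose * X) v) = ‖v‖ ^ 2 - ‖euclMap X v‖ ^ 2 := by
    rw [euclMap_one_sub, inner_sub_right, inner_euclMap_transpose, real_inner_self_eq_norm_sq,
      real_inner_self_eq_norm_sq]
  rw [weightedNorm, Real.sq_sqrt, h]
  rw [h]
  have := norm_euclMap_le X hX v
  have := norm_nonneg (euclMap X v)
  nlinarith

/-- The basic inequality: the growth bound at the true coefficient vector `βs`, for one step
`β ↦ Θ(β + Xᵀy - XᵀXβ)` with `y = X βs + e`. The cross term between the two errors is split by the
Cauchy–Schwarz inequality for the semi-inner product of `I - XᵀX`. -/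
theorem IsThresholding.basic_inequality {Θ : ℝ → ℝ → ℝ} {lam : ℝ} (hΘ : IsThresholding Θ)
    (hlam : 0 ≤ lam) (hX : ‖euclMap X‖ ≤ 1) (β βs : EuclideanSpace ℝ (Fin p))
    (e : EuclideanSpace ℝ (Fin n)) {β' : EuclideanSpace ℝ (Fin p)}
    (hβ' : β' = thetaVec Θ lam (β + euclMap X.transpose (euclMap X βs + e)
      - euclMap (X.transpose * X) β)) :
    (1 - critNumber Θ lam) / 2 * ‖β' - βs‖ ^ 2 + 1 / 2 * ‖euclMap X (β' - βs)‖ ^ 2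
        + penThetaVec Θ lam β'
      ≤ 1 / 2 * weightedNorm (1 - X.transpose * X) (β - βs) ^ 2
        + inner ℝ e (euclMap X (β' - βs)) + penThetaVec Θ lam βs := by
  set d := β - βs with hd
  set d' := β' - βs with hd'
  set z := β + euclMap X.transpose (euclMap X βs + e) - euclMap (X.transpose * X) β with hz
  have hgr := hΘ.quadratic_growth_vec hlam βs z
  rw [← hβ'] at hgr
  have hzd : z - βs = d - euclMap X.transpose (euclMap X d) + euclMap X.transpose e := by
    rw [hz, euclMap_mul_transpose, hd, map_sub, map_sub, map_add]
    abel
  have h1 : ‖βs - z‖ ^ 2 = ‖z - βs‖ ^ 2 := by rw [norm_sub_rev]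
  have h2 : ‖β' - z‖ ^ 2 = ‖d'‖ ^ 2 - 2 * inner ℝ d' (z - βs) + ‖z - βs‖ ^ 2 := by
    rw [← norm_sub_sq_real, hd']
    congr 2
    abel
  have h3 : ‖βs - β'‖ ^ 2 = ‖d'‖ ^ 2 := by rw [norm_sub_rev]
  have h4 : inner ℝ d' (z - βs)
      = inner ℝ d' d - inner ℝ (euclMap X d') (euclMap X d) + inner ℝ e (euclMap X d') := by
    rw [hzd, inner_add_right, inner_sub_right, inner_euclMap_transpose, inner_euclMap_transpose,
      real_inner_comm e]
  have hpos : ‖euclMap X (d' - d)‖ ^ 2 ≤ ‖d' - d‖ ^ 2 := by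
    gcongr
    exact norm_euclMap_le X hX _
  rw [map_sub, norm_sub_sq_real, norm_sub_sq_real] at hpos
  rw [weightedNorm_sq X hX]
  rw [h1, h2, h3, h4] at hgr
  linarith

end Iteration

/-! ### From the hard-thresholding penalty to the number of nonzero entries -/

section Noise

variable {n p : ℕ} (X : Matrix (Fin n) (Fin p) ℝ)

theorem penH_zero {lam : ℝ} (hlam : 0 ≤ lam) : penH lam 0 = 0 := by
  rcases hlam.eq_or_lt with h | h
  · simp [penH, ← h]
  · simp [penH, h]

theorem penH_of_le {lam t : ℝ} (h : lam ≤ |t|) : penH lam t = lam ^ 2 / 2 := by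
  simp [penH, not_lt.mpr h]

/-- Reduction to vectors whose nonzero entries are at least `lam` in size. In each coordinate,
between `0` and `± lam`, the difference of the two sides is concave, because `a ≤ ϑ` and the columns
of `X` have norm at most one; so its minimum there is attained at an end point, where the penalty
`P_H` is `lam² / 2` times the indicator of a nonzero entry. -/
theorem inner_le_penHVec {lam a ϑ : ℝ} (hlam : 0 < lam) (ha : 0 ≤ a) (haϑ : a ≤ ϑ)
    (hX : ‖euclMap X‖ ≤ 1) (e : EuclideanSpace ℝ (Fin n))
    (h : ∀ d : EuclideanSpace ℝ (Fin p),
      inner ℝ e (euclMap X d) ≤ a / 2 * ‖euclMap X d‖ ^ 2 + ϑ * (lam ^ 2 / 2 * numNonzero d))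
    (d : EuclideanSpace ℝ (Fin p)) :
    inner ℝ e (euclMap X d) ≤ a / 2 * ‖euclMap X d‖ ^ 2 + ϑ * penHVec lam d := by
  classical
  suffices hs : ∀ (s : Finset (Fin p)) (d : EuclideanSpace ℝ (Fin p)),
      (∀ j ∉ s, d j = 0 ∨ lam ≤ |d j|) →
      inner ℝ e (euclMap X d) ≤ a / 2 * ‖euclMap X d‖ ^ 2 + ϑ * penHVec lam d from
    hs Finset.univ d (by simp)
  intro s
  induction s using Finset.induction_on with
  | empty =>
    intro d hd
    convert h d using 3
    have : ∀ j, penH lam (d j) = if d j ≠ 0 then lam ^ 2 / 2 else 0 := by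
      intro j
      rcases hd j (by simp) with h0 | h0
      · simp [h0, penH_zero hlam.le]
      · have : d j ≠ 0 := by
          rintro h1
          rw [h1, abs_zero] at h0
          linarith
        simp [this, penH_of_le h0]
    rw [penHVec, Finset.sum_congr rfl fun j _ => this j, ← Finset.sum_filter, Finset.sum_const,
      numNonzero, Set.ncard_eq_toFinset_card']
    simp [mul_comm]
  | insert j s hj ih =>
    intro d hd
    by_cases hdj : d j = 0 ∨ lam ≤ |d j|
    · refine ih d fun i hi => ?_
      by_cases hij : i = j
      · rw [hij]; exact hdj
      · exact hd i (by simp [hij, hi])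
    push Not at hdj
    obtain ⟨hdj0, hdjl⟩ := hdj
    -- `d` is the convex combination, with weights `1 - τ` and `τ`, of the vectors `d₀` and `d₁`
    set x : EuclideanSpace ℝ (Fin p) := EuclideanSpace.single j (d j / |d j|) with hx
    set τ := |d j| / lam with hτ
    have habs : 0 < |d j| := abs_pos.mpr hdj0
    have hτ0 : 0 ≤ τ := by positivity
    have hτ1 : τ ≤ 1 := (div_le_one hlam).mpr hdjl.le
    have hτl : τ * lam = |d j| := by rw [hτ]; field_simp
    have hxn : ‖x‖ = 1 := by
      rw [hx, PiLp.norm_single, Real.norm_eq_abs, abs_div, abs_abs, div_self habs.ne']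
    have hxj : x j = d j / |d j| := by simp [hx]
    have hxi : ∀ i, i ≠ j → x i = 0 := fun i hi => by simp [hx, hi]
    have hdx : d j = |d j| * x j := by rw [hxj]; field_simp
    set d₀ := d - |d j| • x with hd₀
    set d₁ := d₀ + lam • x with hd₁
    have h0j : d₀ j = 0 := by
      simp only [hd₀, PiLp.sub_apply, PiLp.smul_apply, smul_eq_mul]; linarith
    have h1j : |d₁ j| = lam := by
      simp only [hd₁, PiLp.add_apply, PiLp.smul_apply, smul_eq_mul, h0j, hxj]
      rw [zero_add, abs_mul, abs_div, abs_abs, div_self habs.ne', abs_of_pos hlam, mul_one]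
    have h0i : ∀ i, i ≠ j → d₀ i = d i := fun i hi => by simp [hd₀, hxi i hi]
    have h1i : ∀ i, i ≠ j → d₁ i = d i := fun i hi => by simp [hd₁, hxi i hi, h0i i hi]
    have i0 := ih d₀ fun i hi => by
      by_cases hij : i = j
      · rw [hij]; exact Or.inl h0j
      · rw [h0i i hij]; exact hd i (by simp [hij, hi])
    have i1 := ih d₁ fun i hi => by
      by_cases hij : i = j
      · rw [hij]; exact Or.inr h1j.ge
      · rw [h1i i hij]; exact hd i (by simp [hij, hi])
    have hsplit : ∀ v : EuclideanSpace ℝ (Fin p), penHVec lam v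
        = penH lam (v j) + ∑ i ∈ Finset.univ.erase j, penH lam (v i) := fun v =>
      (Finset.add_sum_erase _ _ (Finset.mem_univ j)).symm
    have hr0 : ∑ i ∈ Finset.univ.erase j, penH lam (d₀ i)
        = ∑ i ∈ Finset.univ.erase j, penH lam (d i) :=
      Finset.sum_congr rfl fun i hi => by rw [h0i i (Finset.ne_of_mem_erase hi)]
    have hr1 : ∑ i ∈ Finset.univ.erase j, penH lam (d₁ i)
        = ∑ i ∈ Finset.univ.erase j, penH lam (d i) :=
      Finset.sum_congr rfl fun i hi => by rw [h1i i (Finset.ne_of_mem_erase hi)]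
    have hpd : penH lam (d j) = -(τ * lam) ^ 2 / 2 + lam * (τ * lam) := by
      rw [penH, if_pos hdjl, hτl, sq_abs]
    rw [hsplit, hr0, h0j, penH_zero hlam.le] at i0
    rw [hsplit, hr1, penH_of_le h1j.ge] at i1
    rw [hsplit, hpd]
    set R := ∑ i ∈ Finset.univ.erase j, penH lam (d i)
    have hdd : d = d₀ + (τ * lam) • x := by rw [hd₀, hτl]; abel
    have hXd : euclMap X d = euclMap X d₀ + (τ * lam) • euclMap X x := by
      rw [hdd]; simp
    have hXd1 : euclMap X d₁ = euclMap X d₀ + lam • euclMap X x := by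
      rw [hd₁]; simp
    have hXx : ‖euclMap X x‖ ^ 2 ≤ 1 := by
      have := norm_euclMap_le X hX x
      rw [hxn] at this
      have := norm_nonneg (euclMap X x)
      nlinarith
    have hcx : a * ‖euclMap X x‖ ^ 2 ≤ ϑ := by nlinarith [sq_nonneg ‖euclMap X x‖]
    rw [hXd1, norm_add_sq_real, inner_add_right, inner_smul_right, inner_smul_right, norm_smul,
      mul_pow, Real.norm_eq_abs, sq_abs] at i1
    rw [hXd, norm_add_sq_real, inner_add_right, inner_smul_right, inner_smul_right, norm_smul,
      mul_pow, Real.norm_eq_abs, sq_abs]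
    have hq : 0 ≤ τ * (1 - τ) * lam ^ 2 * (ϑ - a * ‖euclMap X x‖ ^ 2) :=
      mul_nonneg (mul_nonneg (mul_nonneg hτ0 (by linarith)) (sq_nonneg _)) (by linarith)
    have j0 := mul_le_mul_of_nonneg_left i0 (by linarith : 0 ≤ 1 - τ)
    have j1 := mul_le_mul_of_nonneg_left i1 hτ0
    linear_combination j0 + j1 + hq / 2

end Noise

/-! ### Gaussian integrals -/

section GaussianIntegral

variable {V : Type*} [NormedAddCommGroup V] [InnerProductSpace ℝ V] [FiniteDimensional ℝ V]
  [MeasurableSpace V] [BorelSpace V]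

theorem lintegral_exp_neg_mul_sq_norm {b : ℝ} (hb : 0 < b) :
    ∫⁻ v : V, ENNReal.ofReal (Real.exp (-b * ‖v‖ ^ 2))
      = ENNReal.ofReal ((Real.pi / b) ^ (Module.finrank ℝ V / 2 : ℝ)) := by
  rw [← GaussianFourier.integral_rexp_neg_mul_sq_norm hb, ofReal_integral_eq_lintegral_ofReal]
  · refine not_imp_comm.1 integral_undef ?_
    rw [GaussianFourier.integral_rexp_neg_mul_sq_norm hb]
    positivity
  · exact Eventually.of_forall fun v => (Real.exp_pos _).le

/-- The Laplace transform of an isotropic Gaussian weight, by completing the square. -/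
theorem lintegral_exp_neg_mul_sq_norm_add_inner {b : ℝ} (hb : 0 < b) (w : V) :
    ∫⁻ v : V, ENNReal.ofReal (Real.exp (-b * ‖v‖ ^ 2 + inner ℝ w v))
      = ENNReal.ofReal ((Real.pi / b) ^ (Module.finrank ℝ V / 2 : ℝ))
        * ENNReal.ofReal (Real.exp (‖w‖ ^ 2 / (4 * b))) := by
  have h : ∀ v : V, ENNReal.ofReal (Real.exp (-b * ‖v‖ ^ 2 + inner ℝ w v))
      = ENNReal.ofReal (Real.exp (-b * ‖v - (1 / (2 * b)) • w‖ ^ 2))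
        * ENNReal.ofReal (Real.exp (‖w‖ ^ 2 / (4 * b))) := by
    intro v
    rw [← ENNReal.ofReal_mul (Real.exp_pos _).le, ← Real.exp_add, norm_sub_sq_real,
      inner_smul_right, norm_smul, mul_pow, Real.norm_eq_abs, sq_abs, real_inner_comm v w]
    congr 2
    field_simp
    ring
  simp_rw [h]
  rw [lintegral_mul_const' _ _ ENNReal.ofReal_ne_top,
    lintegral_sub_right_eq_self (fun v : V => ENNReal.ofReal (Real.exp (-b * ‖v‖ ^ 2))),
    lintegral_exp_neg_mul_sq_norm hb]

end GaussianIntegral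

/-! ### Projections of sub-Gaussian vectors -/

section SubGaussian

variable {Ω : Type*} [MeasurableSpace Ω] {μ : Measure Ω} {n : ℕ}
  {ε : Ω → EuclideanSpace ℝ (Fin n)} {σ : ℝ}

/-- The infimum in the `ψ₂`-norm is over `s > 0`, hence not attained for a variable that vanishes
almost surely; the bound is stated for `s` strictly above `σ ‖a‖`, which covers this case. -/
theorem IsSubGaussianVec.lintegral_exp_sq_le (h : IsSubGaussianVec ε μ σ)
    (a : EuclideanSpace ℝ (Fin n)) {s : ℝ} (hs0 : 0 < s) (hs : σ * ‖a‖ < s) :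
    ∫⁻ ω, ENNReal.ofReal (Real.exp (inner ℝ (ε ω) a ^ 2 / s ^ 2)) ∂μ ≤ 2 := by
  have h1 : psi2Norm (fun ω => inner ℝ (ε ω) a) μ < ENNReal.ofReal s :=
    (h.scale a).trans_lt ((ENNReal.ofReal_lt_ofReal_iff hs0).mpr hs)
  simp only [psi2Norm, iInf_lt_iff] at h1
  obtain ⟨r, ⟨hr0, hr⟩, hrs⟩ := h1
  have hrs' : r ≤ s := ((ENNReal.ofReal_lt_ofReal_iff hs0).mp hrs).le
  refine le_trans (lintegral_mono fun ω => ?_) hr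
  gcongr

/-- A bound for the moment generating function of the marginals. The constant in front makes
centering unnecessary: it results from `x ≤ x² / s² + s² / 4`. -/
theorem IsSubGaussianVec.lintegral_exp_inner_le [IsProbabilityMeasure μ]
    (h : IsSubGaussianVec ε μ σ) (hσ : 0 < σ) (a : EuclideanSpace ℝ (Fin n)) :
    ∫⁻ ω, ENNReal.ofReal (Real.exp (inner ℝ (ε ω) a)) ∂μ
      ≤ 2 * ENNReal.ofReal (Real.exp (σ ^ 2 * ‖a‖ ^ 2)) := by
  rcases eq_or_ne a 0 with rfl | ha
  · simp
  have ha' : 0 < ‖a‖ := norm_pos_iff.mpr ha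
  have hs0 : 0 < 2 * (σ * ‖a‖) := by positivity
  have hle : ∀ ω, ENNReal.ofReal (Real.exp (inner ℝ (ε ω) a))
      ≤ ENNReal.ofReal (Real.exp (inner ℝ (ε ω) a ^ 2 / (2 * (σ * ‖a‖)) ^ 2))
        * ENNReal.ofReal (Real.exp (σ ^ 2 * ‖a‖ ^ 2)) := by
    intro ω
    rw [← ENNReal.ofReal_mul (Real.exp_pos _).le, ← Real.exp_add]
    refine ENNReal.ofReal_le_ofReal (Real.exp_le_exp.mpr ?_)
    rw [← div_pow]
    set x : ℝ := inner ℝ (ε ω) a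
    have hx : x = x / (2 * (σ * ‖a‖)) * (2 * (σ * ‖a‖)) := by field_simp
    nlinarith [sq_nonneg (x / (2 * (σ * ‖a‖)) - σ * ‖a‖)]
  refine (lintegral_mono hle).trans ?_
  rw [lintegral_mul_const' _ _ ENNReal.ofReal_ne_top]
  gcongr
  exact h.lintegral_exp_sq_le a hs0 (by linarith [mul_pos hσ ha'])

/-- An exponential moment of the squared norm of a projection of the noise, of the order
`2 ^ (r / 2)` in the dimension `r`. The square is linearized by integrating the moment generating
function of the marginals against a Gaussian weight on the subspace. -/
theorem IsSubGaussianVec.lintegral_exp_sq_norm_starProjection_le [IsProbabilityMeasure μ]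
    (h : IsSubGaussianVec ε μ σ) (hσ : 0 < σ) (W : Submodule ℝ (EuclideanSpace ℝ (Fin n))) :
    ∫⁻ ω, ENNReal.ofReal (Real.exp (‖W.starProjection (ε ω)‖ ^ 2 / (8 * σ ^ 2))) ∂μ
      ≤ 2 * ENNReal.ofReal (2 ^ (Module.finrank ℝ W / 2 : ℝ)) := by
  set r : ℝ := Module.finrank ℝ W / 2 with hr
  set G : ℝ → ℝ≥0∞ := fun b => ENNReal.ofReal ((Real.pi / b) ^ r) with hG
  have hb : 0 < 2 * σ ^ 2 := by positivity
  have hb' : 0 < σ ^ 2 := by positivity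
  have hlin : ∀ ω, ∫⁻ v : W, ENNReal.ofReal
        (Real.exp (-(2 * σ ^ 2) * ‖v‖ ^ 2 + inner ℝ (ε ω) (v : EuclideanSpace ℝ (Fin n))))
      = G (2 * σ ^ 2)
        * ENNReal.ofReal (Real.exp (‖W.starProjection (ε ω)‖ ^ 2 / (8 * σ ^ 2))) := by
    intro ω
    have h1 := lintegral_exp_neg_mul_sq_norm_add_inner hb (W.orthogonalProjectionOnto (ε ω))
    have h2 : ∀ v : W, inner ℝ (W.orthogonalProjectionOnto (ε ω)) v
        = inner ℝ (ε ω) (v : EuclideanSpace ℝ (Fin n)) := fun v => by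
      simp
    simp_rw [h2] at h1
    rw [h1, hG]
    congr 4
    ring
  have hmeas : AEMeasurable (Function.uncurry fun (ω : Ω) (v : W) => ENNReal.ofReal
      (Real.exp (-(2 * σ ^ 2) * ‖v‖ ^ 2 + inner ℝ (ε ω) (v : EuclideanSpace ℝ (Fin n)))))
      (μ.prod volume) := by
    have hε : AEMeasurable (fun q : Ω × W => ε q.1) (μ.prod volume) :=
      h.aemeasurable.comp_quasiMeasurePreserving Measure.quasiMeasurePreserving_fst
    have hv : Measurable fun q : Ω × W => (q.2 : EuclideanSpace ℝ (Fin n)) :=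
      measurable_subtype_coe.comp measurable_snd
    have hn : Measurable fun q : Ω × W => ‖q.2‖ := measurable_snd.norm
    exact (((hn.pow_const 2).const_mul _).aemeasurable.add
      (hε.inner hv.aemeasurable)).exp.ennreal_ofReal
  have hswap : G (2 * σ ^ 2)
      * ∫⁻ ω, ENNReal.ofReal (Real.exp (‖W.starProjection (ε ω)‖ ^ 2 / (8 * σ ^ 2))) ∂μ
      ≤ 2 * G (σ ^ 2) := by
    rw [← lintegral_const_mul' _ _ (show G (2 * σ ^ 2) ≠ ⊤ from ENNReal.ofReal_ne_top)]
    simp_rw [← hlin]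
    have hGσ : G (σ ^ 2) = ∫⁻ v : W, ENNReal.ofReal (Real.exp (-(σ ^ 2) * ‖v‖ ^ 2)) :=
      (lintegral_exp_neg_mul_sq_norm hb').symm
    rw [lintegral_lintegral_swap hmeas, hGσ,
      ← lintegral_const_mul' _ _ ENNReal.ofNat_ne_top]
    refine lintegral_mono fun v => ?_
    simp_rw [Real.exp_add, ENNReal.ofReal_mul (Real.exp_pos _).le]
    rw [lintegral_const_mul' _ _ ENNReal.ofReal_ne_top]
    refine (mul_le_mul_right (h.lintegral_exp_inner_le hσ (v : EuclideanSpace ℝ (Fin n))) _).trans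
      (le_of_eq ?_)
    rw [mul_left_comm, ← ENNReal.ofReal_mul (Real.exp_pos _).le, ← Real.exp_add,
      Submodule.coe_norm]
    congr 3
    ring
  have hG2 : G (σ ^ 2) = G (2 * σ ^ 2) * ENNReal.ofReal (2 ^ r) := by
    rw [hG, ← ENNReal.ofReal_mul (by positivity), ← Real.mul_rpow (by positivity) (by norm_num)]
    field_simp
  rw [hG2, mul_left_comm] at hswap
  exact (ENNReal.mul_le_mul_iff_right (ENNReal.ofReal_pos.mpr (by positivity)).ne'
    ENNReal.ofReal_ne_top).mp hswap

/-- A tail bound for the projection of the noise on a subspace of dimension at most `k`. -/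
theorem IsSubGaussianVec.measure_le_sq_norm_starProjection_le [IsProbabilityMeasure μ]
    (h : IsSubGaussianVec ε μ σ) (hσ : 0 < σ) (W : Submodule ℝ (EuclideanSpace ℝ (Fin n)))
    {k : ℕ} (hk : Module.finrank ℝ W ≤ k) (x : ℝ) :
    μ {ω | σ ^ 2 * x ≤ ‖W.starProjection (ε ω)‖ ^ 2}
      ≤ ENNReal.ofReal (2 * (2 ^ k * Real.exp (-x / 8))) := by
  have hm : AEMeasurable
      (fun ω => ENNReal.ofReal (Real.exp (‖W.starProjection (ε ω)‖ ^ 2 / (8 * σ ^ 2)))) μ :=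
    (((W.starProjection.continuous.measurable.comp_aemeasurable h.aemeasurable).norm.pow_const
      2).div_const _).exp.ennreal_ofReal
  have hsub : {ω | σ ^ 2 * x ≤ ‖W.starProjection (ε ω)‖ ^ 2} ⊆
      {ω | ENNReal.ofReal (Real.exp (x / 8))
        ≤ ENNReal.ofReal (Real.exp (‖W.starProjection (ε ω)‖ ^ 2 / (8 * σ ^ 2)))} := by
    intro ω hω
    refine ENNReal.ofReal_le_ofReal (Real.exp_le_exp.mpr ?_)
    rw [div_le_div_iff₀ (by norm_num) (by positivity)]
    have : σ ^ 2 * x ≤ ‖W.starProjection (ε ω)‖ ^ 2 := hω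
    linarith
  refine (measure_mono hsub).trans ((meas_ge_le_lintegral_div hm
    (ENNReal.ofReal_pos.mpr (Real.exp_pos _)).ne' ENNReal.ofReal_ne_top).trans ?_)
  have hpow : (2 : ℝ) ^ (Module.finrank ℝ W / 2 : ℝ) ≤ 2 ^ k := by
    rw [← Real.rpow_natCast]
    refine Real.rpow_le_rpow_of_exponent_le (by norm_num) ?_
    have : (Module.finrank ℝ W : ℝ) ≤ k := by exact_mod_cast hk
    have : (0 : ℝ) ≤ Module.finrank ℝ W := Nat.cast_nonneg _
    linarith
  calc _ ≤ ENNReal.ofReal (2 * 2 ^ k) / ENNReal.ofReal (Real.exp (x / 8)) := by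
        gcongr
        refine (h.lintegral_exp_sq_norm_starProjection_le hσ W).trans ?_
        rw [ENNReal.ofReal_mul (by norm_num), ENNReal.ofReal_ofNat]
        gcongr
    _ = _ := by
        rw [← ENNReal.ofReal_div_of_pos (Real.exp_pos _), neg_div, Real.exp_neg]
        congr 1
        ring

/-- A union bound over the nonempty sets of coordinates: the weights `x ^ |S|` of the tail bounds
add up to `(1 + x) ^ p - 1`, which is of the order of `p x` when that is small. -/
theorem IsSubGaussianVec.measure_exists_le_sq_norm_starProjection_le [IsProbabilityMeasure μ]
    (h : IsSubGaussianVec ε μ σ) (hσ : 0 < σ) {p : ℕ} (hp : 1 ≤ p)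
    (W : Finset (Fin p) → Submodule ℝ (EuclideanSpace ℝ (Fin n)))
    (hW : ∀ S, Module.finrank ℝ (W S) ≤ S.card) {A : ℝ} (hA : 4 ≤ A) :
    μ {ω | ∃ S : Finset (Fin p), S.Nonempty ∧
        σ ^ 2 * (A ^ 2 * Real.log (Real.exp 1 * p) * S.card) ≤ ‖(W S).starProjection (ε ω)‖ ^ 2}
      ≤ ENNReal.ofReal (4 * (p : ℝ) ^ (-(1 / 16 * A ^ 2))) := by
  have hp0 : (0 : ℝ) < p := by exact_mod_cast hp
  have hlog : Real.log (Real.exp 1 * p) = 1 + Real.log p := by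
    rw [Real.log_mul (Real.exp_pos _).ne' hp0.ne', Real.log_exp]
  have hlp : 0 ≤ Real.log p := Real.log_nonneg (by exact_mod_cast hp)
  set L := Real.log (Real.exp 1 * p) with hL
  set x := 2 * Real.exp (-(A ^ 2 * L) / 8) with hx
  have hx0 : 0 ≤ x := by positivity
  have hA2 : 16 ≤ A ^ 2 := by nlinarith
  have hpx : p * x ≤ (p : ℝ) ^ (-(1 / 16 * A ^ 2)) := by
    have h2 : (2 : ℝ) ≤ Real.exp 1 := by linarith [Real.add_one_le_exp 1]
    calc p * x = 2 * Real.exp (Real.log p + -(A ^ 2 * L) / 8) := by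
          rw [Real.exp_add, Real.exp_log hp0]; ring
      _ ≤ Real.exp 1 * Real.exp (Real.log p + -(A ^ 2 * L) / 8) := by gcongr
      _ = Real.exp (1 + (Real.log p + -(A ^ 2 * L) / 8)) := (Real.exp_add _ _).symm
      _ ≤ Real.exp (Real.log p * -(1 / 16 * A ^ 2)) := by
          refine Real.exp_le_exp.mpr ?_
          rw [hlog]
          nlinarith
      _ = _ := (Real.rpow_def_of_pos hp0 _).symm
  have hpx1 : p * x ≤ 1 :=
    hpx.trans (Real.rpow_le_one_of_one_le_of_nonpos (by exact_mod_cast hp) (by nlinarith))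
  have hsum : ∑ S ∈ (Finset.univ : Finset (Finset (Fin p))).erase ∅, x ^ S.card ≤ 2 * (p * x) := by
    have h1 : ∑ S : Finset (Fin p), x ^ S.card = (x + 1) ^ p := by
      have := Fintype.sum_pow_mul_eq_add_pow (Fin p) x 1
      simpa using this
    have h2 : (x + 1) ^ p ≤ Real.exp (p * x) := by
      rw [Real.exp_nat_mul]
      gcongr
      exact Real.add_one_le_exp x
    have h3 := Real.abs_exp_sub_one_le (x := p * x)
      (by rw [abs_of_nonneg (by positivity)]; exact hpx1)
    rw [abs_of_nonneg (by positivity : 0 ≤ p * x)] at h3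
    have h4 := le_abs_self (Real.exp (p * x) - 1)
    have h5 := Finset.add_sum_erase Finset.univ (fun S : Finset (Fin p) => x ^ S.card)
      (Finset.mem_univ ∅)
    simp only [Finset.card_empty, pow_zero] at h5
    linarith
  have hsub : {ω | ∃ S : Finset (Fin p), S.Nonempty ∧
        σ ^ 2 * (A ^ 2 * L * S.card) ≤ ‖(W S).starProjection (ε ω)‖ ^ 2} ⊆
      ⋃ S ∈ (Finset.univ : Finset (Finset (Fin p))).erase ∅,
        {ω | σ ^ 2 * (A ^ 2 * L * S.card) ≤ ‖(W S).starProjection (ε ω)‖ ^ 2} := by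
    rintro ω ⟨S, hS, hω⟩
    simp only [Set.mem_iUnion]
    exact ⟨S, Finset.mem_erase.mpr ⟨hS.ne_empty, Finset.mem_univ _⟩, hω⟩
  refine (measure_mono hsub).trans ((measure_biUnion_finset_le _ _).trans ?_)
  calc _ ≤ ∑ S ∈ (Finset.univ : Finset (Finset (Fin p))).erase ∅,
        ENNReal.ofReal (2 * x ^ S.card) := by
        refine Finset.sum_le_sum fun S _ => ?_
        refine (h.measure_le_sq_norm_starProjection_le hσ (W S) (hW S) _).trans (le_of_eq ?_)
        rw [hx, mul_pow, ← Real.exp_nat_mul]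
        congr 4
        ring
    _ = ENNReal.ofReal (2 * ∑ S ∈ (Finset.univ : Finset (Finset (Fin p))).erase ∅, x ^ S.card) := by
        rw [Finset.mul_sum, ENNReal.ofReal_sum_of_nonneg fun S _ => by positivity]
    _ ≤ _ := ENNReal.ofReal_le_ofReal (by linarith)

/-- A vector of scale zero vanishes: `E ξ² ≤ s² E exp(ξ² / s²) ≤ 2 s²` for every `s > 0` and every
coordinate `ξ`. -/
theorem IsSubGaussianVec.ae_eq_zero (h : IsSubGaussianVec ε μ 0) : ∀ᵐ ω ∂μ, ε ω = 0 := by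
  have hcoord : ∀ i, ∀ᵐ ω ∂μ, ε ω i = 0 := by
    intro i
    have hm : AEMeasurable (fun ω => ENNReal.ofReal (ε ω i ^ 2)) μ :=
      (((EuclideanSpace.proj i : EuclideanSpace ℝ (Fin n) →L[ℝ] ℝ).continuous.measurable
        |>.comp_aemeasurable h.aemeasurable).pow_const 2).ennreal_ofReal
    have hle : ∀ s : ℝ, 0 < s → ∫⁻ ω, ENNReal.ofReal (ε ω i ^ 2) ∂μ
        ≤ ENNReal.ofReal (s ^ 2) * 2 := by
      intro s hs
      have h1 := h.lintegral_exp_sq_le (EuclideanSpace.single i 1) hs (by simpa using hs)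
      refine le_trans ?_ (mul_le_mul_right h1 _)
      rw [← lintegral_const_mul' _ _ ENNReal.ofReal_ne_top]
      refine lintegral_mono fun ω => ?_
      rw [← ENNReal.ofReal_mul (sq_nonneg s)]
      refine ENNReal.ofReal_le_ofReal ?_
      have h2 := Real.add_one_le_exp (ε ω i ^ 2 / s ^ 2)
      have h3 : ε ω i ^ 2 = s ^ 2 * (ε ω i ^ 2 / s ^ 2) := by field_simp
      have h4 : inner ℝ (ε ω) (EuclideanSpace.single i (1 : ℝ)) = ε ω i := by
        rw [EuclideanSpace.inner_single_right]; simp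
      rw [h4]
      nlinarith [sq_nonneg s]
    have h0 : ∫⁻ ω, ENNReal.ofReal (ε ω i ^ 2) ∂μ = 0 := by
      have hlim : Tendsto (fun s : ℝ => ENNReal.ofReal (s ^ 2) * 2)
          (nhdsWithin 0 (Set.Ioi 0)) (nhds (ENNReal.ofReal (0 ^ 2) * 2)) := by
        refine Tendsto.mono_left ?_ nhdsWithin_le_nhds
        exact ENNReal.Tendsto.mul_const
          (ENNReal.tendsto_ofReal ((continuous_pow 2).tendsto 0)) (by simp)
      have := ge_of_tendsto hlim (by
        filter_upwards [self_mem_nhdsWithin] with s hs using hle s hs)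
      simpa using this
    rw [lintegral_eq_zero_iff' hm] at h0
    filter_upwards [h0] with ω hω
    have : ε ω i ^ 2 ≤ 0 := by simpa using hω
    exact pow_eq_zero_iff (two_ne_zero) |>.mp (le_antisymm this (sq_nonneg _))
  filter_upwards [ae_all_iff.mpr hcoord] with ω hω
  ext i
  exact hω i

end SubGaussian

/-! ### Uniform control of the stochastic term -/

section Stochastic

variable {n p : ℕ} (X : Matrix (Fin n) (Fin p) ℝ)

/-- The span of the columns of `X` with index in `S`. -/
noncomputable def columnSpan (S : Finset (Fin p)) : Submodule ℝ (EuclideanSpace ℝ (Fin n)) :=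
  Submodule.span ℝ (S.image fun j => euclMap X (EuclideanSpace.single j 1) : Finset _)

theorem finrank_columnSpan_le (S : Finset (Fin p)) :
    Module.finrank ℝ (columnSpan X S) ≤ S.card :=
  (finrank_span_finset_le_card _).trans Finset.card_image_le

theorem euclMap_mem_columnSpan {S : Finset (Fin p)} {d : EuclideanSpace ℝ (Fin p)}
    (hd : ∀ j ∉ S, d j = 0) : euclMap X d ∈ columnSpan X S := by
  have h : d = ∑ j ∈ S, d j • EuclideanSpace.single j (1 : ℝ) := by
    ext i
    by_cases hi : i ∈ S
    · simp [Finset.sum_apply, Pi.single_apply, hi]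
    · simp [Finset.sum_apply, Pi.single_apply, hi, hd i hi]
  rw [h, map_sum]
  refine Submodule.sum_mem _ fun j hj => ?_
  rw [map_smul]
  exact Submodule.smul_mem _ _ (Submodule.subset_span (by
    simpa using ⟨j, hj, rfl⟩))

/-- If the projections of the noise on the column spans are small, then the stochastic term is
absorbed by the prediction error and an `ℓ₀` penalty. -/
theorem inner_euclMap_le_numNonzero {a x : ℝ} (ha : 0 < a) (e : EuclideanSpace ℝ (Fin n))
    (he : ∀ S : Finset (Fin p), S.Nonempty →
      ‖(columnSpan X S).starProjection e‖ ^ 2 ≤ x * S.card) (d : EuclideanSpace ℝ (Fin p)) :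
    inner ℝ e (euclMap X d) ≤ a / 2 * ‖euclMap X d‖ ^ 2 + x / (2 * a) * numNonzero d := by
  classical
  set S : Finset (Fin p) := Finset.univ.filter fun j => d j ≠ 0 with hS
  have hcard : numNonzero d = S.card := by
    rw [numNonzero, Set.ncard_eq_toFinset_card', hS]
    congr 1
    ext j
    simp
  rcases S.eq_empty_or_nonempty with h0 | h0
  · have hd : d = 0 := by
      ext j
      by_contra hj
      have : j ∈ S := by simpa [hS] using hj
      simp [h0] at this
    rw [hcard, h0, hd]
    simp
  have hmem : euclMap X d ∈ columnSpan X S :=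
    euclMap_mem_columnSpan X fun j hj => by simpa [hS] using hj
  have hin : inner ℝ e (euclMap X d)
      = inner ℝ ((columnSpan X S).starProjection e) (euclMap X d) := by
    have := Submodule.starProjection_inner_eq_zero e _ hmem
    rw [inner_sub_left] at this
    linarith
  rw [hin, hcard]
  have h1 := real_inner_le_norm ((columnSpan X S).starProjection e) (euclMap X d)
  have h2 := he S h0
  set u := ‖(columnSpan X S).starProjection e‖
  set v := ‖euclMap X d‖
  have h3 : u * v ≤ a / 2 * v ^ 2 + u ^ 2 / (2 * a) := by
    have h4 : a / 2 * v ^ 2 + u ^ 2 / (2 * a) - u * v = (a * v - u) ^ 2 / (2 * a) := by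
      field_simp
      ring
    have h5 : 0 ≤ (a * v - u) ^ 2 / (2 * a) := by positivity
    linarith
  have h6 : u ^ 2 / (2 * a) ≤ x / (2 * a) * S.card := by
    rw [div_mul_eq_mul_div]
    gcongr
  linarith

variable {Ω : Type*} [MeasurableSpace Ω] {μ : Measure Ω} {ε : Ω → EuclideanSpace ℝ (Fin n)}
  {σ : ℝ}

/-- Outside an event of small probability, the stochastic term is dominated uniformly in `d` by
the prediction error and the hard-thresholding penalty. Uniformity is what allows arbitrary
dependence between the starting point and the noise. -/
theorem IsSubGaussianVec.exists_event_inner_le [IsProbabilityMeasure μ]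
    (h : IsSubGaussianVec ε μ σ) (hσ : 0 ≤ σ) (hp : 1 ≤ p) (hX : ‖euclMap X‖ ≤ 1)
    {δ ϑ A lam : ℝ} (hδ : 0 < δ) (hϑ : 0 < ϑ) (hA : 4 ≤ A)
    (hlam : lam = A * σ * Real.sqrt (Real.log (Real.exp 1 * p)) / Real.sqrt (min δ ϑ * ϑ)) :
    ∃ B : Set Ω, μ B ≤ ENNReal.ofReal (4 * (p : ℝ) ^ (-(1 / 16 * A ^ 2))) ∧
      ∀ ω ∉ B, ∀ d : EuclideanSpace ℝ (Fin p),
        inner ℝ (ε ω) (euclMap X d) ≤ δ / 2 * ‖euclMap X d‖ ^ 2 + ϑ * penHVec lam d := by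
  rcases hσ.eq_or_lt with rfl | hσ
  · -- without noise `lam = 0`, and `P_H` vanishes
    refine ⟨{ω | ¬ ε ω = 0}, ?_, fun ω hω d => ?_⟩
    · rw [ae_iff.mp h.ae_eq_zero]
      exact zero_le
    · have h0 : ε ω = 0 := not_not.mp hω
      have hl : lam = 0 := by simp [hlam]
      have hpen : penHVec lam d = 0 :=
        Finset.sum_eq_zero fun j _ => by rw [hl, penH_of_le (abs_nonneg _)]; simp
      rw [h0, hpen, inner_zero_left]
      positivity
  set L := Real.log (Real.exp 1 * p) with hL
  have hp1 : (1 : ℝ) ≤ p := by exact_mod_cast hp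
  have hL0 : 0 < L := by
    rw [hL, Real.log_mul (Real.exp_pos _).ne' (by positivity), Real.log_exp]
    linarith [Real.log_nonneg hp1]
  set a := min δ ϑ with ha
  have ha0 : 0 < a := lt_min hδ hϑ
  have hlam0 : 0 < lam := by
    rw [hlam]
    have : 0 < A := by linarith
    positivity
  have hlam2 : ϑ * (lam ^ 2 / 2) = σ ^ 2 * (A ^ 2 * L) / (2 * a) := by
    rw [hlam, div_pow, mul_pow, Real.sq_sqrt hL0.le, Real.sq_sqrt (by positivity)]
    field_simp
  refine ⟨_, h.measure_exists_le_sq_norm_starProjection_le hσ hp (columnSpan X)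
    (finrank_columnSpan_le X) hA, fun ω hω d => ?_⟩
  have he : ∀ S : Finset (Fin p), S.Nonempty →
      ‖(columnSpan X S).starProjection (ε ω)‖ ^ 2 ≤ σ ^ 2 * (A ^ 2 * L) * S.card := by
    intro S hS
    by_contra! hcon
    exact hω ⟨S, hS, by rw [← mul_assoc]; exact hcon.le⟩
  have hmain := inner_le_penHVec X hlam0 ha0.le (min_le_right δ ϑ) hX (ε ω) (fun d => by
    have := inner_euclMap_le_numNonzero X ha0 (ε ω) he d
    rwa [← hlam2, mul_assoc] at this) d
  have : a / 2 * ‖euclMap X d‖ ^ 2 ≤ δ / 2 * ‖euclMap X d‖ ^ 2 := by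
    gcongr
    exact min_le_left _ _
  linarith

end Stochastic

end ThetaEst

/-- The constants `A₀, C, c` are universal. In each part, the event that the comparison condition
holds at `β^{(t+1)}` while the error bound fails has (outer) probability at most `C p^{-c A²}`; so
if the condition is satisfied (almost surely), the bound holds with probability at least
`1 - C p^{-c A²}`. The starting point `β₀` may depend on the data in an arbitrary way. -/
theorem theorem5 :
    ∃ A₀ C c : ℝ, 0 < A₀ ∧ 0 < C ∧ 0 < c ∧
      ∀ (n p : ℕ), 1 ≤ p →
      ∀ (X : Matrix (Fin n) (Fin p) ℝ), ‖ThetaEst.euclMap X‖ ≤ 1 →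
      ∀ (Θ : ℝ → ℝ → ℝ), ThetaEst.IsThresholding Θ →
      ∀ (Ω : Type*) [MeasurableSpace Ω] (μ : Measure Ω) [IsProbabilityMeasure μ]
        (σ : ℝ) (ε : Ω → EuclideanSpace ℝ (Fin n)),
        0 ≤ σ → ThetaEst.IsSubGaussianVec ε μ σ →
      ∀ (βstar : EuclideanSpace ℝ (Fin p)) (y : Ω → EuclideanSpace ℝ (Fin n)),
        (∀ ω, y ω = ThetaEst.euclMap X βstar + ε ω) →
      ∀ (δ ϑ K A lam : ℝ), 0 < δ → 0 < ϑ → 0 ≤ K → A₀ ≤ A →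
        lam = A * σ * Real.sqrt (Real.log (Real.exp 1 * p)) / Real.sqrt (min δ ϑ * ϑ) →
      ∀ (β₀ : Ω → EuclideanSpace ℝ (Fin p)) (β : ℕ → Ω → EuclideanSpace ℝ (Fin p)),
        (∀ t ω, β t ω = ThetaEst.tisp Θ lam X (y ω) (β₀ ω) t) →
      ∀ t : ℕ,
        μ {ω | ThetaEst.CondS0 X Θ δ ϑ K βstar (β (t + 1) ω) lam ∧
            ¬ ((1 + δ) / 2
                  * ThetaEst.weightedNorm (1 - X.transpose * X) (β (t + 1) ω - βstar) ^ 2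
                ≤ 1 / 2 * ThetaEst.weightedNorm (1 - X.transpose * X) (β t ω - βstar) ^ 2
                  + (K + 1) * ThetaEst.penThetaVec Θ lam βstar)}
          ≤ ENNReal.ofReal (C * (p : ℝ) ^ (-(c * A ^ 2))) ∧
        μ {ω | ThetaEst.CondS1 X Θ δ ϑ K βstar (β (t + 1) ω) lam ∧
            ¬ ((1 + δ) / 2
                  * ThetaEst.weightedNorm (1 - X.transpose * X) (β (t + 1) ω - βstar) ^ 2
                ≤ 1 / 2 * ThetaEst.weightedNorm (1 - X.transpose * X) (β t ω - βstar) ^ 2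
                  + (K + 1) * lam ^ 2 * ThetaEst.numNonzero βstar)}
          ≤ ENNReal.ofReal (C * (p : ℝ) ^ (-(c * A ^ 2))) := by
  refine ⟨4, 4, 1 / 16, by norm_num, by norm_num, by norm_num, ?_⟩
  intro n p hp X hX Θ hΘ Ω _ μ _ σ ε hσ hε βstar y hy δ ϑ K A lam hδ hϑ _ hA hlam β₀ β hβ t
  obtain ⟨B, hB, hgood⟩ :=
    hε.exists_event_inner_le X hσ hp hX hδ hϑ hA hlam
  have hlam0 : 0 ≤ lam := by
    have : 0 ≤ A := by linarith
    rw [hlam]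
    positivity
  have hstep : ∀ ω, β (t + 1) ω = ThetaEst.thetaVec Θ lam
      (β t ω + ThetaEst.euclMap X.transpose (ThetaEst.euclMap X βstar + ε ω)
        - ThetaEst.euclMap (X.transpose * X) (β t ω)) := by
    intro ω
    rw [hβ, hβ, ← hy]
    rfl
  constructor
  all_goals
    refine (measure_mono ?_).trans hB
    rintro ω ⟨hcond, hfail⟩
    by_contra hω
    refine hfail ?_
    have hbasic := hΘ.basic_inequality X hlam0 hX (β t ω) βstar (ε ω) (hstep ω)
    have hnoise := hgood ω hω (β (t + 1) ω - βstar)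
    rw [ThetaEst.weightedNorm_sq X hX (β (t + 1) ω - βstar)]
    first | rw [ThetaEst.CondS0] at hcond | rw [ThetaEst.CondS1] at hcond
    linarith
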